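/- Let $n\ge 1$ be an integer. The $(2n+1)$-cube is the graph whose vertices are all bitstrings of length $2n+1$, with an edge between any two bitstrings that differ in exactly one bit; the Hamming weight of a bitstring is the number of its 1s. Then the subgraph of the $(2n+1)$-cube induced by the middle four levels, i.e., by all bitstrings with Hamming weight in the interval $[n-1,n+2]$, has a Hamilton cycle (a cycle that visits every vertex of this subgraph exactly once). -/

import Mathlib

/-- Bitstrings of length `N`. -/
abbrev Bitstring (N : ℕ) : Type := Fin N → Bool

/-- The Hamming weight of a bitstring: the number of positions that carry a 1. -/
def weight {N : ℕ} (x : Bitstring N) : ℕ :=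
  (Finset.univ.filter fun i => x i = true).card

/-- The `N`-cube: its vertices are the bitstrings of length `N`, and two of them are adjacent
when they differ in exactly one bit. -/
def cube (N : ℕ) : SimpleGraph (Bitstring N) where
  Adj x y := hammingDist x y = 1
  symm := ⟨fun x y h => by rw [hammingDist_comm]; exact h⟩
  loopless := ⟨fun x h => by simp at h⟩

/-- All bitstrings of length `N` whose Hamming weight lies in the interval `[a, b]`. -/
def levels (N a b : ℕ) : Set (Bitstring N) :=
  {x | a ≤ weight x ∧ weight x ≤ b}

/-- A graph has a Hamilton cycle: a closed walk of length at least three without repeated edges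
or vertices, apart from the common end, that visits every vertex. -/
def HasHamiltonCycle {V : Type*} [DecidableEq V] (G : SimpleGraph V) : Prop :=
  ∃ (v : V) (p : G.Walk v v), p.IsHamiltonianCycle

/-! Read a bitstring as a lattice path, with 1 as an up-step and 0 as a down-step. The middle four
levels are the paths of final height 3, 1, -1 or -3, and `revCompl` is a graph automorphism that
negates the final height.

`MatchUp` describes a perfect matching. Order the up-steps of a path by height and, at equal height,
from right to left. Between heights 1 and 3 the matching flips the second up-step of the upper path,
between -3 and -1 the first one, and `MiddleFlip` pairs the paths left over (`Matched.unique`,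
`IsCentral.exists_matched`). Together with its mirror image it covers the graph by cycles, where a
common edge counts as a cycle of length two.

Two matching edges that agree up to the last bit, with different last bits, are opposite sides of a
quadrilateral, and may be exchanged for the other two sides. Every matching edge lies in at most one
such quadrilateral, so the exchanges are independent. If they connect all cycles, then a suitable
subset of them merges everything into one cycle (`exists_single_cycle`).

Connectivity is `CubeInvariant.eq`: a labelling constant on cycles and across quadrilaterals is
constant. Alternating paths inside the top two levels bring every path of height 1 to the form `u1d`
with `u`, `d` Dyck (`UpperInvariant.exists_dyck`); the two lowest levels follow by mirroring. One
quadrilateral then empties `d` (`CubeInvariant.collect`), so Dyck words `u` represent all labels.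
Comparing two ways out of the same path yields the moves `absorb` and `release` on Dyck words, and
these reduce each of them to `1(10)^n0`. -/

/-! ### Lattice words, heights and Dyck words -/

/-- The excess of ones over zeros in a word. -/
def exc : List Bool → ℤ
  | [] => 0
  | true :: w => exc w + 1
  | false :: w => exc w - 1

/-- Reverse a word and complement all of its bits. -/
def revCompl (w : List Bool) : List Bool := (w.map not).reverse

/-- Every suffix has at least as many zeros as ones: the word ends at its minimal height. -/
def EndsLow (w : List Bool) : Prop := ∀ s t, w = s ++ t → exc t ≤ 0

/-- Every prefix has at least as many ones as zeros: the word starts at its minimal height. -/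
def StartsLow (w : List Bool) : Prop := ∀ s t, w = s ++ t → 0 ≤ exc s

/-- Dyck words, with `true` as the opening bracket. -/
def IsDyck (w : List Bool) : Prop := EndsLow w ∧ StartsLow w

/-- The word reaches its minimal height only at its end. -/
def EndsLowest (w : List Bool) : Prop := w = [] ∨ ∃ p, EndsLow p ∧ w = p ++ [false]

@[simp] theorem exc_nil : exc [] = 0 := rfl
@[simp] theorem exc_true (w : List Bool) : exc (true :: w) = exc w + 1 := rfl
@[simp] theorem exc_false (w : List Bool) : exc (false :: w) = exc w - 1 := rfl

@[simp] theorem exc_append (s t : List Bool) : exc (s ++ t) = exc s + exc t := by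
  induction s with
  | nil => simp
  | cons b s ih => cases b <;> simp [ih] <;> ring

@[simp] theorem revCompl_nil : revCompl [] = [] := rfl

@[simp] theorem revCompl_append (s t : List Bool) :
    revCompl (s ++ t) = revCompl t ++ revCompl s := by simp [revCompl]

@[simp] theorem revCompl_cons (b : Bool) (s : List Bool) :
    revCompl (b :: s) = revCompl s ++ [!b] := by simp [revCompl]

@[simp] theorem revCompl_revCompl (s : List Bool) : revCompl (revCompl s) = s := by
  simp [revCompl, List.map_reverse, Function.comp_def]

@[simp] theorem length_revCompl (s : List Bool) : (revCompl s).length = s.length := by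
  simp [revCompl]

@[simp] theorem exc_revCompl (s : List Bool) : exc (revCompl s) = - exc s := by
  induction s with
  | nil => simp
  | cons b s ih => cases b <;> simp [ih] <;> ring

theorem revCompl_eq_iff {s t : List Bool} : revCompl s = t ↔ s = revCompl t :=
  ⟨fun h => by rw [← h, revCompl_revCompl], fun h => by rw [h, revCompl_revCompl]⟩

theorem EndsLow.exc_nonpos {w : List Bool} (h : EndsLow w) : exc w ≤ 0 := h [] w rfl

theorem StartsLow.exc_nonneg {w : List Bool} (h : StartsLow w) : 0 ≤ exc w := h w [] (by simp)

theorem IsDyck.exc_eq {w : List Bool} (h : IsDyck w) : exc w = 0 :=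
  le_antisymm h.1.exc_nonpos h.2.exc_nonneg

theorem EndsLow.revCompl {w : List Bool} (h : EndsLow w) : StartsLow (revCompl w) := by
  intro s t hst
  rw [revCompl_eq_iff, revCompl_append] at hst
  have := h _ _ hst
  simp at this; exact this

theorem StartsLow.revCompl {w : List Bool} (h : StartsLow w) : EndsLow (revCompl w) := by
  intro s t hst
  rw [revCompl_eq_iff, revCompl_append] at hst
  have := h _ _ hst
  simp at this; exact this

theorem IsDyck.revCompl {w : List Bool} (h : IsDyck w) : IsDyck (revCompl w) :=
  ⟨h.2.revCompl, h.1.revCompl⟩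

theorem EndsLow.right {s t : List Bool} (h : EndsLow (s ++ t)) : EndsLow t := by
  rintro p q rfl
  exact h (s ++ p) q (by simp)

theorem StartsLow.left {s t : List Bool} (h : StartsLow (s ++ t)) : StartsLow s := by
  rintro p q rfl
  exact h p (q ++ t) (by simp)

theorem EndsLow.append {s t : List Bool} (hs : EndsLow s) (ht : EndsLow t) :
    EndsLow (s ++ t) := by
  intro p q h
  rcases List.append_eq_append_iff.1 h with ⟨r, rfl, rfl⟩ | ⟨r, rfl, rfl⟩
  · exact ht _ _ rfl
  · have h1 := hs _ _ rfl
    have h2 := ht.exc_nonpos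
    simp; omega

theorem StartsLow.append {s t : List Bool} (hs : StartsLow s) (ht : StartsLow t) :
    StartsLow (s ++ t) := by
  intro p q h
  rcases List.append_eq_append_iff.1 h with ⟨r, rfl, rfl⟩ | ⟨r, rfl, rfl⟩
  · have h1 := ht _ _ rfl
    have h2 := hs.exc_nonneg
    simp; omega
  · exact hs _ _ rfl

theorem EndsLow.nil : EndsLow [] := by
  intro s t h
  simp at h; simp [h.2]

theorem StartsLow.nil : StartsLow [] := by
  intro s t h
  simp at h; simp [h.1]

theorem IsDyck.nil : IsDyck [] := ⟨.nil, .nil⟩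

theorem IsDyck.append {s t : List Bool} (hs : IsDyck s) (ht : IsDyck t) : IsDyck (s ++ t) :=
  ⟨hs.1.append ht.1, hs.2.append ht.2⟩

theorem EndsLow.of_cons {b : Bool} {w : List Bool} (hw : EndsLow w) (h : exc (b :: w) ≤ 0) :
    EndsLow (b :: w) := by
  intro s t hst
  cases s with
  | nil => simp at hst; exact hst ▸ h
  | cons c s => simp at hst; exact hw s t hst.2

theorem endsLow_false : EndsLow [false] := EndsLow.nil.of_cons (by simp)

theorem startsLow_true : StartsLow [true] := endsLow_false.revCompl

theorem EndsLow.false_cons {w : List Bool} (hw : EndsLow w) : EndsLow (false :: w) :=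
  endsLow_false.append hw

theorem StartsLow.true_cons {w : List Bool} (hw : StartsLow w) : StartsLow (true :: w) :=
  startsLow_true.append hw

theorem EndsLowest.endsLow {w : List Bool} (h : EndsLowest w) : EndsLow w := by
  rcases h with rfl | ⟨p, hp, rfl⟩
  · exact .nil
  · exact hp.append endsLow_false

theorem EndsLow.endsLowest {p : List Bool} (h : EndsLow p) : EndsLowest (p ++ [false]) :=
  .inr ⟨p, h, rfl⟩

theorem EndsLow.startsLow {w : List Bool} (h : EndsLow w) (h0 : exc w = 0) : StartsLow w := by
  rintro s t rfl
  have := h _ _ rfl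
  simp at h0; omega

theorem EndsLow.isDyck {w : List Bool} (h : EndsLow w) (h0 : 0 ≤ exc w) : IsDyck w :=
  ⟨h, h.startsLow (le_antisymm h.exc_nonpos h0)⟩

theorem StartsLow.isDyck {w : List Bool} (h : StartsLow w) (h0 : exc w ≤ 0) : IsDyck w := by
  have := (h.revCompl.isDyck (by simp; omega)).revCompl
  simpa using this

theorem IsDyck.wrap {u : List Bool} (h : IsDyck u) : IsDyck (true :: u ++ [false]) :=
  StartsLow.isDyck (by
    intro s t hst
    rcases List.append_eq_append_iff.1 hst with ⟨r, rfl, h2⟩ | ⟨r, h1, rfl⟩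
    · cases r with
      | nil => have := h.exc_eq; simp; omega
      | cons c r =>
        simp at h2
        obtain ⟨rfl, rfl, rfl⟩ := h2
        have := h.exc_eq; simp; omega
    · exact h.2.true_cons _ _ h1) (by have := h.exc_eq; simp; omega)

theorem IsDyck.cons {u v : List Bool} (hu : IsDyck u) (hv : IsDyck v) :
    IsDyck (true :: (u ++ false :: v)) := by
  have := hu.wrap.append hv
  simpa using this

theorem IsDyck.snoc {u v : List Bool} (hu : IsDyck u) (hv : IsDyck v) :
    IsDyck (u ++ true :: (v ++ [false])) := by
  have := hu.append hv.wrap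
  simpa using this

/-! ### Decompositions of words at extremal heights, and their uniqueness -/

/-- Split a word at the last visit of its minimal height. -/
theorem exists_lastMin (w : List Bool) :
    ∃ p s, w = p ++ s ∧ EndsLow p ∧ (s = [] ∨ ∃ s', StartsLow s' ∧ s = true :: s') := by
  induction w with
  | nil => exact ⟨[], [], rfl, .nil, .inl rfl⟩
  | cons b w ih =>
    obtain ⟨p, s, rfl, hp, hs⟩ := ih
    have hsl : StartsLow s := by
      rcases hs with rfl | ⟨s', h, rfl⟩
      · exact .nil
      · exact h.true_cons
    by_cases hb : exc (b :: p) ≤ 0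
    · exact ⟨b :: p, s, rfl, hp.of_cons hb, hs⟩
    · have h0 := hp.exc_nonpos
      cases b with
      | false => simp at hb; omega
      | true =>
        simp at hb
        exact ⟨[], true :: (p ++ s), rfl, .nil, .inr ⟨_, (hp.startsLow (by omega)).append hsl, rfl⟩⟩

/-- Split a word at the first visit of its minimal height. -/
theorem exists_firstMin (w : List Bool) :
    ∃ p s, w = p ++ s ∧ EndsLowest p ∧ StartsLow s := by
  obtain ⟨p, s, h, hp, hs⟩ := exists_lastMin (revCompl w)
  rw [revCompl_eq_iff, revCompl_append] at h
  refine ⟨_, _, h, ?_, hp.revCompl⟩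
  rcases hs with rfl | ⟨s', hs', rfl⟩
  · exact .inl rfl
  · exact .inr ⟨_, hs'.revCompl, by simp⟩

theorem StartsLow.exists_lastZero {w : List Bool} (h : StartsLow w) (h0 : 0 < exc w) :
    ∃ u s, w = u ++ true :: s ∧ IsDyck u ∧ StartsLow s := by
  obtain ⟨p, s, rfl, hp, rfl | ⟨s', hs', rfl⟩⟩ := exists_lastMin w
  · have := hp.exc_nonpos
    simp at h0; omega
  · exact ⟨p, s', rfl, hp.isDyck h.left.exc_nonneg, hs'⟩

theorem EndsLow.exists_firstZero {w : List Bool} (h : EndsLow w) (h0 : exc w < 0) :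
    ∃ p u, w = p ++ false :: u ∧ EndsLow p ∧ IsDyck u := by
  obtain ⟨u, s, h1, h2, h3⟩ := h.revCompl.exists_lastZero (by simpa using h0)
  rw [revCompl_eq_iff] at h1
  exact ⟨_, _, by simpa using h1, h3.revCompl, h2.revCompl⟩

/-- The shortest suffix of positive excess begins with an up-step, and the rest of it has excess
zero and ends at its minimum. -/
theorem exists_of_not_endsLow {w : List Bool} (h : ¬ EndsLow w) :
    ∃ p u, w = p ++ true :: u ∧ IsDyck u := by
  induction w with
  | nil => exact absurd .nil h
  | cons b w ih =>
    by_cases hw : EndsLow w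
    · have h1 : ¬ exc (b :: w) ≤ 0 := fun h1 => h (hw.of_cons h1)
      have h2 := hw.exc_nonpos
      cases b with
      | false => simp at h1; omega
      | true => exact ⟨[], w, rfl, hw.isDyck (by simp at h1; omega)⟩
    · obtain ⟨p, u, rfl, hu⟩ := ih hw
      exact ⟨b :: p, u, rfl, hu⟩

/-- The final down-step either reaches a new minimum or closes an excursion from the minimal height.
This dichotomy selects the constructor of `SecondFlip` for a word of excess 3. -/
theorem EndsLow.cases {w : List Bool} (h : EndsLow w) :
    EndsLowest w ∨ ∃ p u, EndsLow p ∧ IsDyck u ∧ w = p ++ true :: (u ++ [false]) := by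
  rcases List.eq_nil_or_concat' w with rfl | ⟨q, b, rfl⟩
  · exact .inl (.inl rfl)
  · have hb : b = false := by
      have := h q [b] rfl
      cases b <;> simp at this ⊢
    subst hb
    by_cases hq : EndsLow q
    · exact .inl hq.endsLowest
    · obtain ⟨p, u, rfl, hu⟩ := exists_of_not_endsLow hq
      refine .inr ⟨p, u, ?_, hu, by simp⟩
      rintro s t rfl
      have h1 := h s (t ++ true :: (u ++ [false])) (by simp)
      have h2 := hu.exc_eq
      simp at h1; omega

theorem IsDyck.cases_last {w : List Bool} (h : IsDyck w) :
    w = [] ∨ ∃ u v, IsDyck u ∧ IsDyck v ∧ w = u ++ true :: (v ++ [false]) := by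
  rcases h.1.cases with (rfl | ⟨p, hp, rfl⟩) | ⟨p, u, hp, hu, rfl⟩
  · exact .inl rfl
  · have h1 := hp.exc_nonpos
    have h2 := h.exc_eq
    simp at h2; omega
  · have h1 := h.exc_eq
    have h2 := hu.exc_eq
    exact .inr ⟨p, u, hp.isDyck (by simp at h1; omega), hu, rfl⟩

theorem IsDyck.cases_first {w : List Bool} (h : IsDyck w) :
    w = [] ∨ ∃ u v, IsDyck u ∧ IsDyck v ∧ w = true :: (u ++ false :: v) := by
  rcases h.revCompl.cases_last with h1 | ⟨u, v, hu, hv, h1⟩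
  · exact .inl (by rw [revCompl_eq_iff] at h1; simpa using h1)
  · rw [revCompl_eq_iff] at h1
    exact .inr ⟨_, _, hv.revCompl, hu.revCompl, by simpa using h1⟩

/-- The last visit of the minimal height is unique. -/
theorem lastMin_unique {p q s t : List Bool} (hp : EndsLow p) (hq : EndsLow q)
    (hs : StartsLow s) (ht : StartsLow t) (h : p ++ true :: s = q ++ true :: t) :
    p = q ∧ s = t := by
  rcases List.append_eq_append_iff.1 h with ⟨r, rfl, h2⟩ | ⟨r, rfl, h2⟩ <;>
    cases r with
    | nil => simpa [eq_comm] using h2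
    | cons c r =>
      simp at h2
      obtain ⟨rfl, rfl⟩ := h2
      first
      | have h3 := hs.left.exc_nonneg
        have h4 := hq.right.exc_nonpos
        simp at h4; omega
      | have h3 := ht.left.exc_nonneg
        have h4 := hp.right.exc_nonpos
        simp at h4; omega

theorem lastDown_unique {p q s t : List Bool} (hp : EndsLow p) (hq : EndsLow q)
    (hs : StartsLow s) (ht : StartsLow t) (h : p ++ false :: s = q ++ false :: t) :
    p = q ∧ s = t := by
  have h' := congrArg revCompl h
  simp at h'
  have := lastMin_unique hs.revCompl ht.revCompl hp.revCompl hq.revCompl h'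
  constructor
  · have h1 := congrArg revCompl this.2; simpa using h1
  · have h1 := congrArg revCompl this.1; simpa using h1

theorem firstMin_unique {p q s t : List Bool} (hp : EndsLowest p) (hq : EndsLowest q)
    (hs : StartsLow s) (ht : StartsLow t) (h : p ++ s = q ++ t) : p = q ∧ s = t := by
  rcases hp with rfl | ⟨p, hp, rfl⟩ <;> rcases hq with rfl | ⟨q, hq, rfl⟩
  · exact ⟨rfl, h⟩
  · simp at h; subst h
    have h1 := StartsLow.left (s := q ++ [false]) (t := t) (by simpa using hs)
    have h2 := h1.exc_nonneg
    have h3 := hq.exc_nonpos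
    simp at h2; omega
  · simp at h; subst h
    have h1 := StartsLow.left (s := p ++ [false]) (t := s) (by simpa using ht)
    have h2 := h1.exc_nonneg
    have h3 := hp.exc_nonpos
    simp at h2; omega
  · simp at h
    obtain ⟨rfl, rfl⟩ := lastDown_unique hp hq hs ht h
    exact ⟨rfl, rfl⟩

theorem firstReturn_unique {u v s t : List Bool} (hu : StartsLow u) (hv : StartsLow v)
    (hu0 : exc u = 0) (hv0 : exc v = 0)
    (h : u ++ false :: s = v ++ false :: t) : u = v ∧ s = t := by
  rcases List.append_eq_append_iff.1 h with ⟨r, rfl, h2⟩ | ⟨r, rfl, h2⟩ <;>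
    cases r with
    | nil => simpa [eq_comm] using h2
    | cons c r =>
      simp at h2
      obtain ⟨rfl, rfl⟩ := h2
      first
      | have h3 := StartsLow.left (s := u ++ [false]) (t := r) (by simpa using hv)
        have h3 := h3.exc_nonneg
        simp at h3; omega
      | have h3 := StartsLow.left (s := v ++ [false]) (t := r) (by simpa using hu)
        have h3 := h3.exc_nonneg
        simp at h3; omega

/-! ### The matching and its three kinds of edges -/

/-- The edges flipping the last step that leaves the minimal height of the upper word. -/
inductive LowFlip : List Bool → List Bool → Prop
  | mk {p s : List Bool} (hp : EndsLow p) (hs : StartsLow s) :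
      LowFlip (p ++ false :: s) (p ++ true :: s)

/-- The edges flipping the second step of the upper word, where its up-steps are ordered by
height and then from right to left. -/
inductive SecondFlip : List Bool → List Bool → Prop
  | single {p u s : List Bool} (hp : EndsLowest p) (hu : IsDyck u) (hs : StartsLow s) :
      SecondFlip (p ++ true :: (u ++ false :: s)) (p ++ true :: (u ++ true :: s))
  | multiple {p u s : List Bool} (hp : EndsLow p) (hu : IsDyck u) (hs : StartsLow s) :
      SecondFlip (p ++ false :: (u ++ false :: true :: s)) (p ++ true :: (u ++ false :: true :: s))

/-- The edges between the two middle levels. -/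
inductive MiddleFlip : List Bool → List Bool → Prop
  | valley {a u b : List Bool} (ha : IsDyck a) (hu : IsDyck u) (hb : IsDyck b) :
      MiddleFlip (a ++ false :: true :: (u ++ false :: b)) (a ++ false :: true :: (u ++ true :: b))
  | outer {d c : List Bool} (hd : IsDyck d) (hc : IsDyck c) :
      MiddleFlip (true :: (d ++ false :: (c ++ [false]))) (true :: (d ++ true :: (c ++ [false])))

/-- The edges of a perfect matching of the middle four levels, from lower to upper words. -/
def MatchUp (x y : List Bool) : Prop :=
  (exc x = 1 ∧ SecondFlip x y) ∨ (exc x = -3 ∧ LowFlip x y) ∨ MiddleFlip x y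

/-- The matching as a symmetric relation. -/
def Matched (x y : List Bool) : Prop := MatchUp x y ∨ MatchUp y x

theorem LowFlip.exc_eq {x y : List Bool} (h : LowFlip x y) : exc y = exc x + 2 := by
  cases h; simp; ring

theorem SecondFlip.exc_eq {x y : List Bool} (h : SecondFlip x y) : exc y = exc x + 2 := by
  cases h <;> simp <;> ring

theorem MiddleFlip.exc_eq {x y : List Bool} (h : MiddleFlip x y) : exc x = -1 ∧ exc y = 1 := by
  cases h with
  | valley ha hu hb => simp [ha.exc_eq, hu.exc_eq, hb.exc_eq]
  | outer hd hc => simp [hd.exc_eq, hc.exc_eq]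

theorem MiddleFlip.endsLow {x y : List Bool} (h : MiddleFlip x y) : EndsLow x := by
  cases h with
  | valley ha hu hb => exact ha.1.append (hu.cons hb).1.false_cons
  | outer hd hc =>
    have := (hd.cons hc).1.append endsLow_false
    simpa using this

/-- Two words that differ in exactly one bit. -/
def FlipAdj (x y : List Bool) : Prop := ∃ s b t, x = s ++ b :: t ∧ y = s ++ (!b) :: t

theorem FlipAdj.symm {x y : List Bool} (h : FlipAdj x y) : FlipAdj y x := by
  obtain ⟨s, b, t, rfl, rfl⟩ := h
  exact ⟨s, !b, t, rfl, by simp⟩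

theorem FlipAdj.length_eq {x y : List Bool} (h : FlipAdj x y) : x.length = y.length := by
  obtain ⟨s, b, t, rfl, rfl⟩ := h
  simp

theorem FlipAdj.revCompl {x y : List Bool} (h : FlipAdj x y) :
    FlipAdj (revCompl x) (revCompl y) := by
  obtain ⟨s, b, t, rfl, rfl⟩ := h
  exact ⟨_root_.revCompl t, !b, _root_.revCompl s, by simp, by simp⟩

theorem LowFlip.flipAdj {x y : List Bool} (h : LowFlip x y) : FlipAdj x y := by
  cases h; exact ⟨_, _, _, rfl, rfl⟩

theorem SecondFlip.flipAdj {x y : List Bool} (h : SecondFlip x y) : FlipAdj x y := by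
  cases h with
  | @single p u s => exact ⟨p ++ true :: u, false, s, by simp, by simp⟩
  | multiple => exact ⟨_, _, _, rfl, rfl⟩

theorem MiddleFlip.flipAdj {x y : List Bool} (h : MiddleFlip x y) : FlipAdj x y := by
  cases h with
  | @valley a u b => exact ⟨a ++ false :: true :: u, false, b, by simp, by simp⟩
  | @outer d c => exact ⟨true :: d, false, c ++ [false], by simp, by simp⟩

theorem MatchUp.exc_eq {x y : List Bool} (h : MatchUp x y) : exc y = exc x + 2 := by
  rcases h with ⟨_, h⟩ | ⟨_, h⟩ | h
  · exact h.exc_eq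
  · exact h.exc_eq
  · simp [h.exc_eq]

theorem MatchUp.exc_cases {x y : List Bool} (h : MatchUp x y) :
    exc x = 1 ∨ exc x = -3 ∨ exc x = -1 := by
  rcases h with ⟨h, _⟩ | ⟨h, _⟩ | h
  · exact .inl h
  · exact .inr (.inl h)
  · exact .inr (.inr h.exc_eq.1)

theorem MatchUp.flipAdj {x y : List Bool} (h : MatchUp x y) : FlipAdj x y := by
  rcases h with ⟨_, h⟩ | ⟨_, h⟩ | h
  · exact h.flipAdj
  · exact h.flipAdj
  · exact h.flipAdj

theorem Matched.symm {x y : List Bool} (h : Matched x y) : Matched y x := Or.symm h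

theorem Matched.flipAdj {x y : List Bool} (h : Matched x y) : FlipAdj x y :=
  h.elim (·.flipAdj) (·.flipAdj.symm)

theorem MatchUp.cases_of_exc_one {x y : List Bool} (h : MatchUp x y) (hx : exc x = 1) :
    SecondFlip x y := by
  rcases h with ⟨_, h⟩ | ⟨h, _⟩ | h
  · exact h
  · omega
  · have := h.exc_eq; omega

theorem MatchUp.cases_of_exc_neg_one {x y : List Bool} (h : MatchUp x y) (hx : exc x = -1) :
    MiddleFlip x y := by
  rcases h with ⟨h, _⟩ | ⟨h, _⟩ | h
  · omega
  · omega
  · exact h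

theorem MatchUp.cases_of_exc_neg_three {x y : List Bool} (h : MatchUp x y) (hx : exc x = -3) :
    LowFlip x y := by
  rcases h with ⟨h, _⟩ | ⟨_, h⟩ | h
  · omega
  · exact h
  · have := h.exc_eq; omega

/-! ### Partners are unique -/

theorem LowFlip.up_unique {x x' y z : List Bool} (h : LowFlip x y) (h' : LowFlip x' z)
    (e : x = x') : y = z := by
  cases h with
  | mk hp hs =>
    cases h' with
    | mk hq ht =>
      obtain ⟨rfl, rfl⟩ := lastDown_unique hp hq hs ht e
      rfl

theorem LowFlip.down_unique {x x' y z : List Bool} (h : LowFlip y x) (h' : LowFlip z x')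
    (e : x = x') : y = z := by
  cases h with
  | mk hp hs =>
    cases h' with
    | mk hq ht =>
      obtain ⟨rfl, rfl⟩ := lastMin_unique hp hq hs ht e
      rfl

theorem StartsLow.ne_return {u s t : List Bool} (ht : StartsLow t) (hu : IsDyck u) :
    u ++ false :: s ≠ t := by
  rintro rfl
  have := StartsLow.left (s := u ++ [false]) (t := s) (by simpa using ht)
  have := this.exc_nonneg
  have := hu.exc_eq
  simp at *; omega

theorem EndsLowest.ne_wrap {p q u : List Bool} (hp : EndsLowest p) (hu : IsDyck u) :
    p ≠ q ++ true :: (u ++ [false]) := by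
  rintro rfl
  have hu := hu.exc_eq
  rcases hp with h | ⟨r, hr, h⟩
  · simp at h
  · have h' : (q ++ true :: u) ++ [false] = r ++ [false] := by simpa using h
    have := List.append_cancel_right h'
    subst this
    have := hr.right.exc_nonpos
    simp at this; omega

theorem IsDyck.wrap_append {u s : List Bool} (hu : IsDyck u) (hs : StartsLow s) :
    StartsLow (true :: (u ++ false :: s)) := by
  have := hu.wrap.2.append hs
  simpa using this

theorem IsDyck.append_true {u s : List Bool} (hu : IsDyck u) (hs : StartsLow s) :
    StartsLow (u ++ true :: s) := hu.2.append hs.true_cons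

theorem IsDyck.append_false {u s : List Bool} (hu : IsDyck u) (hs : EndsLow s) :
    EndsLow (s ++ false :: u) := hs.append hu.1.false_cons

theorem SecondFlip.up_unique {x x' y z : List Bool} (h : SecondFlip x y) (h' : SecondFlip x' z)
    (e : x = x') : y = z := by
  cases h with
  | single hp hu hs =>
    cases h' with
    | single hq hv ht =>
      obtain ⟨rfl, h2⟩ := firstMin_unique hp hq (hu.wrap_append hs) (hv.wrap_append ht) e
      obtain ⟨rfl, rfl⟩ := firstReturn_unique hu.2 hv.2 hu.exc_eq hv.exc_eq (List.cons.inj h2).2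
      rfl
    | multiple hq hv ht =>
      obtain ⟨-, h2⟩ := firstMin_unique hp (hv.append_false hq).endsLowest (hu.wrap_append hs)
        ht.true_cons (by simpa using e)
      exact absurd (List.cons.inj h2).2 (ht.ne_return hu)
  | multiple hp hu hs =>
    cases h' with
    | single hq hv ht =>
      obtain ⟨-, h2⟩ := firstMin_unique hq (hu.append_false hp).endsLowest (hv.wrap_append ht)
        hs.true_cons (by simpa using e.symm)
      exact absurd (List.cons.inj h2).2 (hs.ne_return hv)
    | multiple hq hv ht =>
      obtain ⟨h1, h2⟩ := firstMin_unique (hu.append_false hp).endsLowest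
        (hv.append_false hq).endsLowest hs.true_cons ht.true_cons (by simpa using e)
      obtain ⟨rfl, rfl⟩ := lastDown_unique hp hq hu.2 hv.2 (List.append_cancel_right h1)
      rw [(List.cons.inj h2).2]

theorem SecondFlip.down_unique {x x' y z : List Bool} (h : SecondFlip y x)
    (h' : SecondFlip z x') (e : x = x') : y = z := by
  cases h with
  | single hp hu hs =>
    cases h' with
    | single hq hv ht =>
      obtain ⟨rfl, h2⟩ := lastMin_unique hp.endsLow hq.endsLow (hu.append_true hs)
        (hv.append_true ht) e
      obtain ⟨rfl, rfl⟩ := lastMin_unique hu.1 hv.1 hs ht h2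
      rfl
    | multiple hq hv ht =>
      obtain ⟨h1, -⟩ := lastMin_unique hp.endsLow (hq.append hv.wrap.1) (hu.append_true hs)
        ht (by simpa using e)
      exact absurd h1 (hp.ne_wrap hv)
  | multiple hp hu hs =>
    cases h' with
    | single hq hv ht =>
      obtain ⟨h1, -⟩ := lastMin_unique hq.endsLow (hp.append hu.wrap.1) (hv.append_true ht)
        hs (by simpa using e.symm)
      exact absurd h1 (hq.ne_wrap hu)
    | @multiple q v t hq hv ht =>
      obtain ⟨h1, rfl⟩ := lastMin_unique (hp.append hu.wrap.1) (hq.append hv.wrap.1) hs ht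
        (by simpa using e)
      obtain ⟨rfl, h3⟩ := lastMin_unique hp hq hu.2 hv.2
        (List.append_cancel_right (bs := [false]) (by simpa using h1))
      rw [h3]

theorem MiddleFlip.up_unique {x x' y z : List Bool} (h : MiddleFlip x y) (h' : MiddleFlip x' z)
    (e : x = x') : y = z := by
  cases h with
  | valley ha hu hb =>
    cases h' with
    | valley ha' hu' hb' =>
      obtain ⟨rfl, h2⟩ := lastDown_unique ha.1 ha'.1 (hu.cons hb).2 (hu'.cons hb').2 e
      obtain ⟨rfl, rfl⟩ := firstReturn_unique hu.2 hu'.2 hu.exc_eq hu'.exc_eq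
        (List.cons.inj h2).2
      rfl
    | outer hd hc =>
      obtain ⟨-, h2⟩ := lastDown_unique ha.1 (hd.cons hc).1 (hu.cons hb).2 .nil (by simpa using e)
      simp at h2
  | outer hd hc =>
    cases h' with
    | valley ha' hu' hb' =>
      obtain ⟨-, h2⟩ := lastDown_unique ha'.1 (hd.cons hc).1 (hu'.cons hb').2 .nil
        (by simpa using e.symm)
      simp at h2
    | outer hd' hc' =>
      obtain ⟨rfl, h2⟩ := firstReturn_unique hd.2 hd'.2 hd.exc_eq hd'.exc_eq (List.cons.inj e).2
      rw [h2]

theorem MiddleFlip.down_unique {x x' y z : List Bool} (h : MiddleFlip y x)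
    (h' : MiddleFlip z x') (e : x = x') : y = z := by
  cases h with
  | valley ha hu hb =>
    cases h' with
    | valley ha' hu' hb' =>
      obtain ⟨h1, h2⟩ := firstMin_unique ha.1.endsLowest ha'.1.endsLowest
        (hu.append_true hb.2).true_cons (hu'.append_true hb'.2).true_cons (by simpa using e)
      obtain ⟨rfl, rfl⟩ := lastMin_unique hu.1 hu'.1 hb.2 hb'.2 (List.cons.inj h2).2
      rw [List.append_cancel_right h1]
    | outer hd hc =>
      obtain ⟨h1, -⟩ := firstMin_unique ha.1.endsLowest (.inl rfl)
        (hu.append_true hb.2).true_cons (hd.snoc hc).2.true_cons (by simpa using e)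
      simp at h1
  | outer hd hc =>
    cases h' with
    | valley ha' hu' hb' =>
      obtain ⟨h1, -⟩ := firstMin_unique ha'.1.endsLowest (.inl rfl)
        (hu'.append_true hb'.2).true_cons (hd.snoc hc).2.true_cons (by simpa using e.symm)
      simp at h1
    | outer hd' hc' =>
      obtain ⟨rfl, rfl⟩ := lastMin_unique hd.1 hd'.1 hc.2 hc'.2
        (List.append_cancel_right (bs := [false]) (by simpa using e))
      rfl

/-- The first and last visits of the minimum tell the two apart. The upper end of a `MiddleFlip`
visits its minimum once, at height 0 or -1; the lower end of a `single` flip returns to its minimum,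
and that of a `multiple` flip has its minimum at height -2 or below. -/
theorem SecondFlip.not_middleFlip {x x' y z : List Bool} (h : SecondFlip x y)
    (h' : MiddleFlip z x') : x ≠ x' := by
  intro e
  cases h with
  | single hp hu hs =>
    cases h' with
    | valley ha' hu' hb' =>
      obtain ⟨-, h2⟩ := firstMin_unique hp ha'.1.endsLowest (hu.wrap_append hs)
        (hu'.append_true hb'.2).true_cons (by simpa using e)
      exact (hu'.append_true hb'.2).ne_return hu (List.cons.inj h2).2
    | outer hd hc =>
      obtain ⟨-, h2⟩ := firstMin_unique hp (.inl rfl) (hu.wrap_append hs)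
        (hd.snoc hc).2.true_cons (by simpa using e)
      exact (hd.snoc hc).2.ne_return hu (List.cons.inj h2).2
  | multiple hp hu hs =>
    cases h' with
    | valley ha' hu' hb' =>
      obtain ⟨h1, -⟩ := firstMin_unique (hu.append_false hp).endsLowest ha'.1.endsLowest
        hs.true_cons (hu'.append_true hb'.2).true_cons (by simpa using e)
      have h1 := congrArg exc (List.append_cancel_right h1)
      have h2 := hp.exc_nonpos
      simp [hu.exc_eq, ha'.exc_eq] at h1; omega
    | outer hd hc =>
      obtain ⟨h1, -⟩ := firstMin_unique (hu.append_false hp).endsLowest (.inl rfl)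
        hs.true_cons (hd.snoc hc).2.true_cons (by simpa using e)
      simp at h1

theorem MiddleFlip.not_lowFlip {x y z : List Bool} (h : MiddleFlip x y) (h' : LowFlip z x) :
    False := by
  have := h.endsLow
  cases h' with
  | mk hp hs =>
    have h1 := this.right.exc_nonpos
    have h2 := hs.exc_nonneg
    simp at h1; omega

/-- Only at excess 1 and -1 can one partner lie above and another below; `SecondFlip.not_middleFlip`
and `MiddleFlip.not_lowFlip` exclude this. -/
theorem Matched.unique {x y z : List Bool} (h : Matched x y) (h' : Matched x z) : y = z := by
  rcases h with h | h <;> rcases h' with h' | h'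
  · rcases h.exc_cases with e | e | e
    · exact (h.cases_of_exc_one e).up_unique (h'.cases_of_exc_one e) rfl
    · exact (h.cases_of_exc_neg_three e).up_unique (h'.cases_of_exc_neg_three e) rfl
    · exact (h.cases_of_exc_neg_one e).up_unique (h'.cases_of_exc_neg_one e) rfl
  · have e1 := h'.exc_eq
    rcases h.exc_cases with e | e | e
    · exact absurd rfl
        ((h.cases_of_exc_one e).not_middleFlip (h'.cases_of_exc_neg_one (by omega)))
    · rcases h'.exc_cases with e' | e' | e' <;> omega
    · exact ((h.cases_of_exc_neg_one e).not_lowFlip (h'.cases_of_exc_neg_three (by omega))).elim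
  · have e1 := h.exc_eq
    rcases h'.exc_cases with e | e | e
    · exact absurd rfl
        ((h'.cases_of_exc_one e).not_middleFlip (h.cases_of_exc_neg_one (by omega)))
    · rcases h.exc_cases with e' | e' | e' <;> omega
    · exact ((h'.cases_of_exc_neg_one e).not_lowFlip (h.cases_of_exc_neg_three (by omega))).elim
  · have e1 := h.exc_eq
    have e2 := h'.exc_eq
    rcases h.exc_cases with e | e | e
    · exact (h.cases_of_exc_one e).down_unique (h'.cases_of_exc_one (by omega)) rfl
    · exact (h.cases_of_exc_neg_three e).down_unique (h'.cases_of_exc_neg_three (by omega)) rfl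
    · exact (h.cases_of_exc_neg_one e).down_unique (h'.cases_of_exc_neg_one (by omega)) rfl

/-! ### Partners exist -/

theorem exists_matched_of_exc_three {y : List Bool} (hy : exc y = 3) : ∃ x, Matched y x := by
  obtain ⟨p, s, rfl, hp, rfl | ⟨s, hs, rfl⟩⟩ := exists_lastMin y
  · have := hp.exc_nonpos
    simp at hy; omega
  · have hp0 := hp.exc_nonpos
    rcases hp.cases with hp' | ⟨q, u, hq, hu, rfl⟩
    · obtain ⟨u, s', rfl, hu, hs'⟩ := hs.exists_lastZero (by simp at hy; omega)
      exact ⟨_, .inr (.inl ⟨by simp at hy ⊢; omega, .single hp' hu hs'⟩)⟩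
    · refine ⟨q ++ false :: (u ++ false :: true :: s), .inr (.inl ⟨?_, ?_⟩)⟩
      · simp at hy ⊢; omega
      · simpa using SecondFlip.multiple hq hu hs

/-- A second visit of the minimum gives a `single` edge upwards. If the minimum is visited once, its
height decides: -2 or lower gives `multiple`, -1 gives `valley`, and 0 gives `outer`. In the last
case the one-letter word has no partner, hence the bound on the length. -/
theorem exists_matched_of_exc_one {x : List Bool} (hx : exc x = 1) (hl : 2 ≤ x.length) :
    ∃ y, Matched x y := by
  obtain ⟨p, r, rfl, hp, hr⟩ := exists_firstMin x
  have hp0 := hp.endsLow.exc_nonpos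
  obtain ⟨u, s, rfl, hu, hs⟩ := hr.exists_lastZero (by simp at hx; omega)
  have hu0 := hu.exc_eq
  rcases hu.cases_first with rfl | ⟨v, w, hv, hw, rfl⟩
  · rcases hp with rfl | ⟨q, hq, rfl⟩
    · rcases (hs.isDyck (by simp at hx; omega)).cases_last with rfl | ⟨d, c, hd, hc, rfl⟩
      · simp at hl
      · exact ⟨_, .inr (.inr (.inr (.outer hd hc)))⟩
    · by_cases h0 : exc q < 0
      · obtain ⟨p, u, rfl, hp, hu⟩ := hq.exists_firstZero h0
        exact ⟨_, .inl (.inl ⟨hx, by simpa using SecondFlip.multiple hp hu hs⟩)⟩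
      · have ha := hq.isDyck (by omega)
        have ha0 := ha.exc_eq
        obtain ⟨u, b, rfl, hu, hb⟩ := hs.exists_lastZero (by simp at hx; omega)
        have hu0 := hu.exc_eq
        have hb := hb.isDyck (by simp at hx; omega)
        exact ⟨_, .inr (.inr (.inr (by simpa using MiddleFlip.valley ha hu hb)))⟩
  · exact ⟨_, .inl (.inl ⟨hx, by simpa using SecondFlip.single hp hv (hw.append_true hs)⟩)⟩

/-- A word that leaves its minimum for good is the upper end of a `LowFlip`. Otherwise it ends at
its minimum and is a Dyck word, a down-step and a Dyck word; `outer` serves the case where the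
second Dyck word is empty. -/
theorem exists_matched_of_exc_neg_one {x : List Bool} (hx : exc x = -1) (hl : 2 ≤ x.length) :
    ∃ y, Matched x y := by
  obtain ⟨p, s, rfl, hp, rfl | ⟨s, hs, rfl⟩⟩ := exists_lastMin x
  · obtain ⟨q, u, rfl, hq, hu⟩ := hp.exists_firstZero (by simp at hx; omega)
    have hu0 := hu.exc_eq
    have hq' := hq.isDyck (by simp at hx; omega)
    rcases hu.cases_first with rfl | ⟨v, w, hv, hw, rfl⟩
    · rcases hq'.cases_first with rfl | ⟨v, w, hv, hw, rfl⟩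
      · simp at hl
      · exact ⟨_, .inl (.inr (.inr (by simpa using MiddleFlip.outer hv hw)))⟩
    · exact ⟨_, .inl (.inr (.inr (by simpa using MiddleFlip.valley hq' hv hw)))⟩
  · exact ⟨_, .inr (.inr (.inl ⟨by simp at hx ⊢; omega, .mk hp hs⟩))⟩

theorem exists_matched_of_exc_neg_three {x : List Bool} (hx : exc x = -3) : ∃ y, Matched x y := by
  obtain ⟨p, s, rfl, rfl | ⟨p, hp, rfl⟩, hs⟩ := exists_firstMin x
  · have := hs.exc_nonneg
    simp at hx; omega
  · exact ⟨_, .inl (.inr (.inl ⟨hx, by simpa using LowFlip.mk hp hs⟩))⟩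

/-! ### Alternating paths inside the two upper levels -/

/-- A labelling of words that is constant along the matching edges between excess `1` and `3`. -/
structure UpperInvariant {γ : Type*} (G : List Bool → γ) : Prop where
  second : ∀ x y, exc x = 1 → SecondFlip x y → G x = G y
  low : ∀ x y, exc x = 1 → LowFlip x y → G x = G y

namespace UpperInvariant

variable {γ : Type*} {G : List Bool → γ}

/-- Go up along a `SecondFlip` and come down along a `LowFlip`. -/
theorem swap_step (h : UpperInvariant G) {p u s : List Bool} (hp : EndsLowest p) (hu : IsDyck u)
    (hs : StartsLow s) (he : exc p + exc s = 1) :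
    G (p ++ true :: (u ++ false :: s)) = G (p ++ false :: (u ++ true :: s)) := by
  have hu0 := hu.exc_eq
  rw [h.second _ _ (by simp; omega) (.single hp hu hs),
    h.low _ _ (by simp; omega) (.mk hp.endsLow (hu.append_true hs))]

theorem swap_step' (h : UpperInvariant G) {p u s : List Bool} (hp : EndsLow p) (hu : IsDyck u)
    (hs : StartsLow s) (he : exc p + exc s = 2) :
    G (p ++ false :: (u ++ false :: true :: s)) =
      G (p ++ true :: (u ++ false :: false :: s)) := by
  have hu0 := hu.exc_eq
  rw [h.second _ _ (by simp; omega) (.multiple hp hu hs)]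
  have := h.low _ _ (by simp; omega) (.mk (hp.append hu.wrap.1) hs)
  simpa using this.symm

/-- For `u = 1v0w` the chain is `01v0w → 00v1w → 0v01w → 1v00w → 1v0w0`: the two swaps exchange
brackets, and the second and fourth arrows are inductive slides past `v` and `w`. -/
theorem slide (h : UpperInvariant G) {u : List Bool} (hu : IsDyck u) {p s : List Bool}
    (hp : EndsLow p) (hs : StartsLow s) (he : exc p + exc s = 2) :
    G (p ++ false :: (u ++ s)) = G (p ++ (u ++ false :: s)) := by
  induction hn : u.length using Nat.strong_induction_on generalizing u p s with
  | _ n ih =>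
    subst hn
    rcases hu.cases_first with rfl | ⟨v, w, hv, hw, rfl⟩
    · rfl
    · have hv0 := hv.exc_eq
      have hw0 := hw.exc_eq
      have h1 := h.swap_step hp.endsLowest hv (hw.2.append hs) (by simp; omega)
      have h2 := ih v.length (by simp) hv (p := p ++ [false]) (s := true :: (w ++ s))
        (hp.append endsLow_false) (hw.2.append hs).true_cons (by simp; omega) rfl
      have h3 := h.swap_step' hp hv (hw.2.append hs) (by simp; omega)
      have h4 := ih w.length (by simp; omega) hw (p := p ++ true :: (v ++ [false]))
        (hp.append hv.wrap.1) hs (by simp; omega) rfl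
      simp at h1 h2 h3 h4 ⊢
      rw [h1, h2, h3, h4]

theorem rotate (h : UpperInvariant G) {a b s : List Bool} (ha : IsDyck a) (hb : IsDyck b)
    (hs : StartsLow s) (he : exc s = 1) :
    G (true :: (a ++ (b ++ false :: s))) = G (a ++ false :: (b ++ true :: s)) := by
  have h1 := h.swap_step (p := []) (.inl rfl) (ha.append hb) hs (by simp; omega)
  have h2 := h.slide ha (p := []) .nil (hb.append_true hs) (by simp [hb.exc_eq]; omega)
  simp at h1 h2
  rw [h1, h2]

theorem exists_dyck_aux (h : UpperInvariant G) (k : ℕ) (p s : List Bool) (hp : EndsLow p)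
    (hs : StartsLow s) (he : exc p + exc s = 0) (hk : exc p = -k) :
    ∃ u d, IsDyck u ∧ IsDyck d ∧ u.length + d.length = p.length + s.length ∧
      G (p ++ true :: s) = G (u ++ true :: d) := by
  induction k generalizing p s with
  | zero =>
    exact ⟨p, s, hp.isDyck (by simp at hk; omega), hs.isDyck (by simp at hk; omega), rfl, rfl⟩
  | succ k ih =>
    push_cast at hk
    obtain ⟨r, c, rfl, hr, hc⟩ := hp.exists_firstZero (by omega)
    obtain ⟨v, t, rfl, hv, ht⟩ := hs.exists_lastZero (by omega)
    obtain ⟨q, b, rfl, hq, hb⟩ := exists_firstMin r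
    have hb : IsDyck b := ⟨hr.right, hb⟩
    have hb0 := hb.exc_eq
    have hc0 := hc.exc_eq
    have hv0 := hv.exc_eq
    simp at he hk
    have hvt := hv.append_true ht
    have h1 := h.slide hc hr hvt.true_cons (by simp; omega)
    have h2 := h.slide (hb.append hc) hq.endsLow hvt.true_cons (by simp; omega)
    have h3 := h.swap_step hq (hb.append hc) hvt (by simp; omega)
    -- Slides and a swap turn `q b 0 c 1 v 1 t` into `q 1bc0 v 1 t`, whose minimum is one higher.
    -- The factor `b` is split off because `swap_step` needs a prefix that reaches its minimum only
    -- at its end.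
    obtain ⟨u, d, hu, hd, hl, hG⟩ := ih (q ++ (true :: (b ++ c) ++ [false]) ++ v) t
      ((hq.endsLow.append (hb.append hc).wrap.1).append hv.1) ht (by simp; omega) (by simp; omega)
    refine ⟨u, d, hu, hd, ?_, ?_⟩
    · simp at hl ⊢; omega
    · simp at h1 h2 h3 hG ⊢
      rw [h1, ← h2, ← h3, hG]

theorem exists_dyck (h : UpperInvariant G) {x : List Bool} (hx : exc x = 1) :
    ∃ u d, IsDyck u ∧ IsDyck d ∧ u.length + d.length + 1 = x.length ∧
      G x = G (u ++ true :: d) := by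
  obtain ⟨p, s, rfl, hp, rfl | ⟨s, hs, rfl⟩⟩ := exists_lastMin x
  · have := hp.exc_nonpos
    simp at hx; omega
  · have := hp.exc_nonpos
    obtain ⟨u, d, hu, hd, hl, hG⟩ := h.exists_dyck_aux (exc p).natAbs p s hp hs
      (by simp at hx; omega) (by omega)
    exact ⟨u, d, hu, hd, by simp; omega, hG⟩

theorem exists_lower (h : UpperInvariant G) {y : List Bool} (hy : exc y = 3) :
    ∃ x, exc x = 1 ∧ x.length = y.length ∧ G y = G x := by
  obtain ⟨p, s, rfl, hp, rfl | ⟨s, hs, rfl⟩⟩ := exists_lastMin y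
  · have := hp.exc_nonpos
    simp at hy; omega
  · have h1 : exc (p ++ false :: s) = 1 := by simp at hy ⊢; omega
    exact ⟨_, h1, by simp, (h.low _ _ h1 (.mk hp hs)).symm⟩

end UpperInvariant

/-! ### Labellings of all four levels, and reduction to a Dyck word followed by 1 -/

/-- Since this kind of edge is preserved by mirroring, the mirrored matching uses it between excess
1 and 3, which makes `UpperInvariant` applicable. -/
theorem LowFlip.revCompl {x y : List Bool} (h : LowFlip x y) :
    LowFlip (revCompl y) (revCompl x) := by
  cases h with
  | mk hp hs => simpa using LowFlip.mk hs.revCompl hp.revCompl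

/-- A labelling of words that is constant along the matching, along its mirror image, and along
the quadrilaterals that the matching forms with flips of the last bit. -/
structure CubeInvariant {γ : Type*} (F : List Bool → γ) : Prop where
  up : ∀ x y, MatchUp x y → F x = F y
  mirror : ∀ x y, MatchUp x y → F (revCompl x) = F (revCompl y)
  quad : ∀ x y, MatchUp (x ++ [false]) (y ++ [false]) → MatchUp (x ++ [true]) (y ++ [true]) →
    F (x ++ [false]) = F (x ++ [true])

/-- The word `(10)^k`. -/
def zigzag : ℕ → List Bool
  | 0 => []
  | k + 1 => true :: false :: zigzag k

theorem zigzag_append (k : ℕ) (c : List Bool) :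
    zigzag k ++ true :: false :: c = true :: false :: (zigzag k ++ c) := by
  induction k with
  | zero => rfl
  | succ k ih => simp [zigzag, ih]

theorem isDyck_zigzag (k : ℕ) : IsDyck (zigzag k) := by
  induction k with
  | zero => exact .nil
  | succ k ih => exact IsDyck.nil.cons ih

namespace CubeInvariant

variable {γ : Type*} {F : List Bool → γ}

theorem upper (h : CubeInvariant F) : UpperInvariant F where
  second x y hx hxy := h.up x y (.inl ⟨hx, hxy⟩)
  low x y hx hxy := by
    have := h.mirror _ _ (.inr (.inl ⟨by simp [hxy.exc_eq, hx], hxy.revCompl⟩))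
    simpa using this.symm

theorem lower (h : CubeInvariant F) : UpperInvariant (F ∘ revCompl) where
  second x y hx hxy := h.mirror x y (.inl ⟨hx, hxy⟩)
  low x y hx hxy :=
    (h.up _ _ (.inr (.inl ⟨by simp [hxy.exc_eq, hx], hxy.revCompl⟩))).symm

/-- The quadrilateral here joins a `valley` edge between the middle levels, whose words end in 0, to
a `single` edge of the upper levels, whose words end in 1. Rotations on either side bring the words
to standard form. The Dyck word after the separating 1 becomes empty. -/
theorem collect (h : CubeInvariant F) {a b p q : List Bool} (ha : IsDyck a) (hb : IsDyck b)
    (hp : IsDyck p) (hq : IsDyck q) :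
    F (true :: (a ++ false :: (b ++ true :: (p ++ true :: (q ++ [false]))))) =
      F (true :: (a ++ true :: (b ++ false :: p)) ++ false :: (q ++ [true])) := by
  have ha0 := ha.exc_eq
  have hb0 := hb.exc_eq
  have hp0 := hp.exc_eq
  have hq0 := hq.exc_eq
  have hd := hp.snoc hq
  have h1 := h.upper.rotate ha .nil (hb.append_true hd.2) (by simp; omega)
  have h2 := MiddleFlip.valley ha hb hd
  have h3 : SecondFlip (a ++ false :: true :: (b ++ false :: (p ++ true :: (q ++ [true]))))
      (a ++ false :: true :: (b ++ true :: (p ++ true :: (q ++ [true])))) := by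
    simpa using SecondFlip.single ha.1.endsLowest hb (hp.append_true (hq.append_true .nil))
  have h4 := h.quad (a ++ false :: true :: (b ++ false :: (p ++ true :: q)))
    (a ++ false :: true :: (b ++ true :: (p ++ true :: q))) (.inr (.inr (by simpa using h2)))
    (.inl ⟨by simp; omega, by simpa using h3⟩)
  have h5 := h.upper.rotate ha (hb.cons hp) (hq.append_true .nil) (by simp; omega)
  have h6 := h.up _ _ (.inr (.inr h2))
  simp at h1 h4 h5 h6 ⊢
  rw [h1, ← h6, h4, ← h5]

theorem collect_nil (h : CubeInvariant F) {p q : List Bool} (hp : IsDyck p) (hq : IsDyck q) :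
    F (true :: (p ++ true :: (q ++ [false]))) = F (true :: (p ++ false :: (q ++ [true]))) := by
  have hp0 := hp.exc_eq
  have hq0 := hq.exc_eq
  have h2 := MiddleFlip.outer hp hq
  have h3 := SecondFlip.single (p := []) (.inl rfl) hp (hq.append_true .nil)
  have h4 := h.quad (true :: (p ++ false :: q)) (true :: (p ++ true :: q))
    (.inr (.inr (by simpa using h2))) (.inl ⟨by simp; omega, by simpa using h3⟩)
  have h6 := h.up _ _ (.inr (.inr h2))
  simp at h4 h6 ⊢
  rw [← h6, h4]

theorem exists_root_of_exc_one (h : CubeInvariant F) {x : List Bool} (hx : exc x = 1) :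
    ∃ u, IsDyck u ∧ u.length + 1 = x.length ∧ F x = F (u ++ [true]) := by
  obtain ⟨u, d, hu, hd, hl, hF⟩ := h.upper.exists_dyck hx
  rcases hd.cases_last with rfl | ⟨p, q, hp, hq, rfl⟩
  · exact ⟨u, hu, by simpa using hl, hF⟩
  · rcases hu.cases_first with rfl | ⟨a, b, ha, hb, rfl⟩
    · refine ⟨true :: (p ++ false :: q), hp.cons hq, by simp at hl ⊢; omega, hF.trans ?_⟩
      simpa using h.collect_nil hp hq
    · refine ⟨_, (ha.append (hb.cons hp)).cons hq, by simp at hl ⊢; omega, hF.trans ?_⟩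
      simpa using h.collect ha hb hp hq

theorem exists_root (h : CubeInvariant F) {x : List Bool} (hl : 2 ≤ x.length)
    (hx : exc x = 3 ∨ exc x = 1 ∨ exc x = -1 ∨ exc x = -3) :
    ∃ u, IsDyck u ∧ u.length + 1 = x.length ∧ F x = F (u ++ [true]) := by
  have neg_one : ∀ x : List Bool, 2 ≤ x.length → exc x = -1 →
      ∃ u, IsDyck u ∧ u.length + 1 = x.length ∧ F x = F (u ++ [true]) := by
    intro x hl hx
    obtain ⟨u, d, hu, hd, hlen, hF⟩ := h.lower.exists_dyck (x := revCompl x) (by simp [hx])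
    simp only [Function.comp_apply, revCompl_revCompl] at hF
    -- In mirrored standard form the word is a Dyck word, 0 and a Dyck word, which is the lower end
    -- of a middle edge: `valley` if the second Dyck word is nonempty, `outer` otherwise.
    have key : ∃ y, exc y = 1 ∧ y.length = x.length ∧ F x = F y := by
      have hd' := hd.revCompl
      rcases hu.revCompl.cases_first with h1 | ⟨v, w, hv, hw, h1⟩
      · rcases hd'.cases_first with h2 | ⟨v, w, hv, hw, h2⟩
        · rw [revCompl_eq_iff] at h1 h2
          subst h1 h2
          simp at hlen; omega
        · have hm := MiddleFlip.outer hv hw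
          refine ⟨_, hm.exc_eq.2, ?_, hF.trans ?_⟩
          · have e1 : u.length = 0 := by simpa using congrArg List.length h1
            have e2 := congrArg List.length h2
            simp at hlen e2 ⊢; omega
          · have := h.up _ _ (.inr (.inr hm))
            rw [← this]
            simp [h1, h2]
      · have hm := MiddleFlip.valley hd' hv hw
        refine ⟨_, hm.exc_eq.2, ?_, hF.trans ?_⟩
        · have e1 := congrArg List.length h1
          simp at hlen e1 ⊢; omega
        · have := h.up _ _ (.inr (.inr hm))
          rw [← this]
          simp [h1]
    obtain ⟨y, hy, hyl, hxy⟩ := key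
    obtain ⟨u, hu, hul, hyu⟩ := h.exists_root_of_exc_one hy
    exact ⟨u, hu, by omega, hxy.trans hyu⟩
  rcases hx with hx | hx | hx | hx
  · obtain ⟨y, hy, hyl, hxy⟩ := h.upper.exists_lower hx
    obtain ⟨u, hu, hul, hyu⟩ := h.exists_root_of_exc_one hy
    exact ⟨u, hu, by omega, hxy.trans hyu⟩
  · exact h.exists_root_of_exc_one hx
  · exact neg_one x hl hx
  · obtain ⟨y, hy, hyl, hxy⟩ := h.lower.exists_lower (y := revCompl x) (by simp [hx])
    obtain ⟨u, hu, hul, hyu⟩ := neg_one (revCompl y) (by simp at hyl ⊢; omega) (by simp [hy])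
    refine ⟨u, hu, by simp at hyl hul; omega, ?_⟩
    simp only [Function.comp_apply, revCompl_revCompl] at hxy
    exact hxy.trans hyu

/-! ### Moves on Dyck words, and reduction to the zigzag -/

/-- A round trip through the lower half without quadrilaterals: cross the middle along the matching,
rotate below, and return along the mirrored matching. The way down splits a Dyck word at its first
factor and the way back at its last one; `e` equates the two splittings. -/
theorem advance (h : CubeInvariant F) {a b d a' b' : List Bool} (ha : IsDyck a) (hb : IsDyck b)
    (hd : IsDyck d) (ha' : IsDyck a') (hb' : IsDyck b')
    (e : true :: (b ++ false :: d) = a' ++ true :: (b' ++ [false])) :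
    F (true :: (a ++ false :: (b ++ true :: d))) =
      F (a ++ true :: (a' ++ false :: true :: b')) := by
  have ha0 := ha.exc_eq
  have hb0 := hb.exc_eq
  have hd0 := hd.exc_eq
  have ha0' := ha'.exc_eq
  have h1 := h.upper.rotate ha .nil (hb.append_true hd.2) (by simp; omega)
  have h2 := h.up _ _ (.inr (.inr (.valley ha hb hd)))
  have h3 := h.lower.rotate hb'.revCompl .nil (ha'.append_false ha.1).revCompl (by simp; omega)
  have h4 := h.mirror _ _ (.inr (.inr (.valley hb'.revCompl ha'.revCompl ha.revCompl)))
  simp at h1 h2 h3 h4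
  rw [h1, ← h2, e, h3, ← h4]

/-- For nonempty `a`, `advance` and `collect` lead from one common word to the two sides. -/
theorem shift (h : CubeInvariant F) {a c : List Bool} (ha : IsDyck a) (hc : IsDyck c) :
    F (true :: (a ++ false :: (c ++ [true]))) = F (true :: (a ++ false :: true :: c)) := by
  rcases ha.cases_first with rfl | ⟨b, d, hb, hd, rfl⟩
  · simpa using h.advance .nil hc .nil .nil hc (by simp)
  · have h1 := h.advance .nil hb (hd.snoc hc) (hb.cons hd) hc (by simp)
    have h2 := h.collect .nil hb hd hc
    simp at h1 h2 ⊢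
    rw [← h2, h1]

/-- `shift` followed by `collect`. The first factor swallows a leaf `10` and `c`, leaving the
shorter tail `e`; hence `absorb_all` can empty the tail. -/
theorem absorb (h : CubeInvariant F) {a c e : List Bool} (ha : IsDyck a) (hc : IsDyck c)
    (he : IsDyck e) :
    F (true :: (a ++ false :: (c ++ true :: (e ++ [false, true])))) =
      F (true :: (a ++ true :: false :: (c ++ false :: (e ++ [true])))) := by
  have h1 := h.shift ha (hc.snoc he)
  have h2 := h.collect ha .nil hc he
  simp at h1 h2 ⊢
  rw [h1, h2]

/-- Again `advance` and `collect` start from a common word. A partial inverse to absorption: a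
prefix `a` leaves the outer bracket. -/
theorem release (h : CubeInvariant F) {a b : List Bool} (ha : IsDyck a) (hb : IsDyck b) :
    F (true :: (a ++ (b ++ [false, true]))) = F (a ++ true :: (b ++ [false, true])) := by
  rcases hb.cases_first with rfl | ⟨c, d, hc, hd, rfl⟩
  · simpa using h.advance ha .nil .nil .nil .nil (by simp)
  · have h1 := h.advance ha hc (hd.snoc .nil) (hc.cons hd) .nil (by simp)
    have h2 := h.collect ha hc hd .nil
    simp at h1 h2 ⊢
    rw [← h2, h1]

theorem absorb_all (h : CubeInvariant F) {a c : List Bool} (ha : IsDyck a) (hc : IsDyck c) :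
    ∃ d, IsDyck d ∧ d.length = c.length ∧
      F (true :: (a ++ false :: (c ++ [true]))) = F (true :: (a ++ (d ++ [false, true]))) := by
  induction hn : c.length using Nat.strong_induction_on generalizing a c with
  | _ n ih =>
    subst hn
    rcases hc.cases_last with rfl | ⟨b, e, hb, he, rfl⟩
    · exact ⟨[], .nil, rfl, by simp⟩
    · obtain ⟨d, hd, hl, hF⟩ := ih e.length (by simp; omega) (ha.append (IsDyck.nil.cons hb)) he rfl
      refine ⟨_, (IsDyck.nil.cons hb).append hd, by simp; omega, ?_⟩
      have := h.absorb ha hb he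
      simp at this hF ⊢
      rw [this, hF]

theorem exists_leading_leaf (h : CubeInvariant F) {x y : List Bool} (hx : IsDyck x)
    (hy : IsDyck y) :
    ∃ z, IsDyck z ∧ z.length = x.length + y.length ∧
      F (true :: true :: (x ++ false :: (y ++ [false, true]))) =
        F (true :: true :: false :: (z ++ [false, true])) := by
  induction hn : x.length using Nat.strong_induction_on generalizing x y with
  | _ n ih =>
    subst hn
    rcases hx.cases_first with rfl | ⟨v, w, hv, hw, rfl⟩
    · exact ⟨y, hy, by simp, by simp⟩
    · have h1 := h.release ((hv.cons hw).cons hy) .nil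
      have h2 := h.absorb (hv.cons hw) hy .nil
      -- Releasing all of the content and absorbing it again turns `1(1v0w)0y` inside the outer
      -- bracket into `1v0w10y`, so the first subtree shrinks from `1v0w` to `v`.
      obtain ⟨z, hz, hl, hF⟩ := ih v.length (by simp) hv (hw.append (IsDyck.nil.cons hy)) rfl
      refine ⟨z, hz, by simp at hl ⊢; omega, ?_⟩
      simp at h1 h2 hF ⊢
      rw [h1, h2, hF]

/-- Release the leading leaves, absorb them back without `z`, which becomes the tail, and absorb
that tail: its last bracket pair is traded for one more leading leaf. -/
theorem zigzag_step (h : CubeInvariant F) (k : ℕ) {z : List Bool} (hz : IsDyck z) (hz0 : z ≠ []) :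
    ∃ d, IsDyck d ∧ d.length + 2 = z.length ∧
      F (true :: (zigzag (k + 1) ++ (z ++ [false, true]))) =
        F (true :: (zigzag (k + 2) ++ (d ++ [false, true]))) := by
  obtain rfl | ⟨c, e, hc, he, rfl⟩ := hz.cases_last
  · exact absurd rfl hz0
  · have h1 := h.release (isDyck_zigzag (k + 1)) (hc.snoc he)
    have h2 := h.absorb .nil (isDyck_zigzag k) (hc.snoc he)
    have h3 := h.absorb (isDyck_zigzag (k + 1)) hc he
    obtain ⟨d, hd, hl, hF⟩ := h.absorb_all ((isDyck_zigzag (k + 2)).append hc) he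
    refine ⟨c ++ d, hc.append hd, by simp; omega, ?_⟩
    simp [zigzag, zigzag_append] at h1 h2 h3 hF ⊢
    rw [h1, h2, h3, hF]

theorem eq_zigzag_of_leaf (h : CubeInvariant F) (k m : ℕ) {z : List Bool} (hz : IsDyck z)
    (hl : z.length = 2 * m) :
    F (true :: (zigzag (k + 1) ++ (z ++ [false, true]))) =
      F (true :: (zigzag (k + 1 + m) ++ [false, true])) := by
  induction m generalizing k z with
  | zero =>
    have : z = [] := List.length_eq_zero_iff.1 hl
    subst this; rfl
  | succ m ih =>
    obtain ⟨d, hd, hdl, hF⟩ := h.zigzag_step k hz (by rintro rfl; simp at hl)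
    rw [hF, ih (k + 1) hd (by omega)]
    congr 4; omega

theorem root_eq (h : CubeInvariant F) (n : ℕ) {u : List Bool} (hu : IsDyck u)
    (hl : u.length = 2 * (n + 1)) :
    F (u ++ [true]) = F (true :: (zigzag n ++ [false, true])) := by
  obtain rfl | ⟨a, c, ha, hc, rfl⟩ := hu.cases_first
  · simp at hl
  · obtain ⟨d, hd, hdl, hF⟩ := h.absorb_all ha hc
    have had := ha.append hd
    have hlen : (a ++ d).length = 2 * n := by simp at hl ⊢; omega
    have hF' : F (true :: (a ++ false :: c) ++ [true]) = F (true :: ((a ++ d) ++ [false, true])) := by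
      simpa using hF
    rw [hF']
    generalize a ++ d = w at had hlen
    obtain rfl | ⟨x, y, hx, hy, rfl⟩ := had.cases_first
    · have : n = 0 := by simp at hlen; omega
      subst this; rfl
    · obtain ⟨z, hz, hzl, hF⟩ := h.exists_leading_leaf hx hy
      obtain ⟨m, rfl⟩ : ∃ m, n = m + 1 := ⟨n - 1, by simp at hlen; omega⟩
      have := h.eq_zigzag_of_leaf 0 m hz (by simp at hlen; omega)
      rw [show m + 1 = 0 + 1 + m by omega, ← this]
      simpa [zigzag] using hF

theorem eq (h : CubeInvariant F) {n : ℕ} {x : List Bool} (hl : x.length = 2 * n + 3)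
    (hx : exc x = 3 ∨ exc x = 1 ∨ exc x = -1 ∨ exc x = -3) :
    F x = F (true :: (zigzag n ++ [false, true])) := by
  obtain ⟨u, hu, hul, hF⟩ := h.exists_root (by omega) hx
  exact hF.trans (h.root_eq n hu (by omega))

end CubeInvariant

/-! ### Merging the cycles of a permutation -/

open Equiv in
/-- Multiplying by the transposition of two elements of different cycles merges these cycles. -/
theorem sameCycle_mul_swap {V : Type*} [Fintype V] [DecidableEq V] {f : Perm V} {x y : V}
    (h : ¬ f.SameCycle x y) :
    (f * swap x y).SameCycle x y ∧ ∀ a b, f.SameCycle a b → (f * swap x y).SameCycle a b := by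
  set g := f * swap x y with hg
  have gx : g x = f y := by simp [hg]
  have gy : g y = f x := by simp [hg]
  have gz : ∀ z, z ≠ x → z ≠ y → g z = f z := fun z h1 h2 => by
    simp [hg, swap_apply_of_ne_of_ne h1 h2]
  have hxy : g.SameCycle x y := by
    have hper : 0 < Function.minimalPeriod f y :=
      Function.minimalPeriod_pos_of_mem_periodicPts (f.injective.mem_periodicPts y)
    -- From `x` the new permutation enters the old cycle of `y` at `f y` and follows it, never
    -- meeting `x`, until it arrives at `y`.
    have key : ∀ i, i < Function.minimalPeriod f y → g.SameCycle x (f^[i + 1] y) := by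
      intro i
      induction i with
      | zero =>
        intro _
        rw [zero_add, Function.iterate_one, ← gx]
        exact Perm.sameCycle_apply_right.2 (.refl g x)
      | succ i ih =>
        intro hi
        have h1 := ih (by omega)
        have hne : f^[i + 1] y ≠ y := fun e =>
          Function.not_isPeriodicPt_of_pos_of_lt_minimalPeriod (by omega) hi e
        have hne' : f^[i + 1] y ≠ x := by
          intro e
          apply h
          rw [← e, ← Perm.coe_pow]
          exact (Perm.sameCycle_pow_left).2 (.refl f y)
        rw [Function.iterate_succ_apply', ← gz _ hne' hne]
        exact Perm.sameCycle_apply_right.2 h1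
    have := key (Function.minimalPeriod f y - 1) (by omega)
    rwa [Nat.sub_add_cancel hper, Function.iterate_minimalPeriod] at this
  refine ⟨hxy, ?_⟩
  have step : ∀ a, g.SameCycle a (f a) := by
    intro a
    by_cases hx : a = x
    · subst hx
      rw [← gy]; exact Perm.sameCycle_apply_right.2 hxy
    · by_cases hy : a = y
      · subst hy
        rw [← gx]; exact Perm.sameCycle_apply_right.2 hxy.symm
      · rw [← gz a hx hy]; exact Perm.sameCycle_apply_right.2 (.refl g a)
  intro a b hab
  obtain ⟨n, -, rfl⟩ := hab.exists_pow_eq'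
  clear hab
  induction n with
  | zero => exact .refl g a
  | succ n ih =>
    rw [pow_succ', Perm.mul_apply]
    exact ih.trans (step _)

open Equiv in
/-- If the cycles of a permutation `f` following an adjacency relation are connected through
disjoint exchanges `v ↔ s v`, then some permutation following the relation is a single cycle. -/
theorem exists_single_cycle {V : Type*} [Fintype V] (r : V → V → Prop) (f : Perm V) (s : V → V)
    (hf : ∀ v, r v (f v)) (hs : ∀ v, s (s v) = v) (hr : ∀ v, r v (f (s v)))
    (hconn : ∀ R : Setoid V, (∀ v, R v (f v)) → (∀ v, R v (s v)) → ∀ v w, R v w) :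
    ∃ g : Perm V, (∀ v, r v (g v)) ∧ ∀ v w, g.SameCycle v w := by
  classical
  -- `T` encodes the sets of exchanges carried out. A choice with the most pairs in a common cycle
  -- joins `v` to `s v` for every `v`, since one more transposition would otherwise merge two
  -- cycles.
  let T : Finset (Perm V) := Finset.univ.filter fun t => ∀ v, t v = v ∨ t v = s v
  have hT : T.Nonempty := ⟨1, by simp [T]⟩
  obtain ⟨t, htT, hmax⟩ := T.exists_max_image
    (fun t => (Finset.univ.filter fun p : V × V => (f * t).SameCycle p.1 p.2).card) hT
  have ht : ∀ v, t v = v ∨ t v = s v := by simpa [T] using htT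
  have hsame : ∀ v, (f * t).SameCycle v (s v) := by
    intro v
    by_contra hv
    obtain ⟨h1, h2⟩ := sameCycle_mul_swap hv
    have hvs : v ≠ s v := fun e => hv (by rw [← e])
    have htv : (t v = v ∧ t (s v) = s v) ∨ (t v = s v ∧ t (s v) = v) := by
      have h3 := hs v ▸ ht (s v)
      have h4 : t v ≠ t (s v) := fun e => hvs (t.injective e)
      rcases ht v with e | e <;> rcases h3 with e' | e' <;> simp_all
    have hmem : t * swap v (s v) ∈ T := by
      simp only [T, Finset.mem_filter, Finset.mem_univ, true_and]
      intro w
      by_cases hw : w = v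
      · subst hw
        rcases htv with ⟨_, e⟩ | ⟨_, e⟩ <;> simp [e]
      · by_cases hw' : w = s v
        · subst hw'
          rcases htv with ⟨e, _⟩ | ⟨e, _⟩ <;> simp [e, hs]
        · simpa [swap_apply_of_ne_of_ne hw hw'] using ht w
    have hlt := Finset.card_lt_card (s := Finset.univ.filter fun p : V × V =>
        (f * t).SameCycle p.1 p.2) (t := Finset.univ.filter fun p : V × V =>
        (f * (t * swap v (s v))).SameCycle p.1 p.2) (by
      rw [Finset.ssubset_iff_of_subset]
      · exact ⟨(v, s v), by simpa [← mul_assoc] using h1, by simpa using hv⟩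
      · intro p hp
        simp only [Finset.mem_filter, Finset.mem_univ, true_and] at hp ⊢
        rw [← mul_assoc]; exact h2 _ _ hp)
    exact absurd (hmax _ hmem) (not_le.2 hlt)
  refine ⟨f * t, fun v => ?_, hconn (Perm.SameCycle.setoid (f * t)) (fun v => ?_) hsame⟩
  · rcases ht v with e | e
    · simpa [e] using hf v
    · simpa [e] using hr v
  · change (f * t).SameCycle v (f v)
    have key : ∀ w, t w = v → (f * t).SameCycle w v := by
      intro w hw
      rcases ht w with e | e
      · rw [← hw, e]
      · rw [← hw, e]; exact hsame w
    have h1 := key (t.symm v) (by simp)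
    have h2 : (f * t) (t.symm v) = f v := by simp
    rw [← h2]
    exact Perm.sameCycle_apply_right.2 h1.symm

/-- A permutation that moves every vertex to a neighbour and is a single cycle yields a
Hamilton cycle. -/
theorem hasHamiltonCycle_of_perm {V : Type*} [Fintype V] [DecidableEq V] (G : SimpleGraph V)
    (g : Equiv.Perm V) (hg : ∀ v, G.Adj v (g v)) (hc : ∀ v w, g.SameCycle v w)
    (hV : 3 ≤ Fintype.card V) : HasHamiltonCycle G := by
  obtain ⟨v⟩ : Nonempty V := Fintype.card_pos_iff.1 (by omega)
  have hpos : 0 < Function.minimalPeriod g v :=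
    Function.minimalPeriod_pos_of_mem_periodicPts (g.injective.mem_periodicPts v)
  have hbij : Function.Bijective fun i : Fin (Function.minimalPeriod g v) => g^[i] v := by
    refine ⟨fun i j hij => Fin.ext ?_, fun w => ?_⟩
    · exact Function.iterate_injOn_Iio_minimalPeriod i.2 j.2 hij
    · obtain ⟨i, -, hi⟩ := (hc v w).exists_pow_eq'
      refine ⟨⟨i % Function.minimalPeriod g v, Nat.mod_lt _ hpos⟩, ?_⟩
      simp only [Function.iterate_mod_minimalPeriod_eq]
      rw [← hi, Equiv.Perm.coe_pow]
  have hcard := Fintype.card_of_bijective hbij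
  rw [Fintype.card_fin] at hcard
  obtain ⟨m, hm⟩ : ∃ m, Function.minimalPeriod g v = m + 3 :=
    ⟨_, (Nat.sub_add_cancel (hcard ▸ hV)).symm⟩
  have hmod := fun k => Function.iterate_mod_minimalPeriod_eq (f := g) (x := v) (n := k)
  rw [hm] at hbij hcard
  rw [hm] at hmod
  have hstep : ∀ a b : Fin (m + 3), (a - b).val = 1 → g^[a] v = g (g^[b] v) := by
    intro a b h
    have ha : (a : ℕ) = (b + 1) % (m + 3) := by
      conv_lhs => rw [← add_sub_cancel b a, Fin.val_add, h]
    rw [ha, hmod]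
    exact Function.iterate_succ_apply' g b v
  let φ : SimpleGraph.cycleGraph (m + 3) →g G :=
    { toFun := fun i => g^[i] v
      map_rel' := by
        intro a b hab
        rcases SimpleGraph.cycleGraph_adj'.1 hab with h | h
        · rw [hstep a b h]; exact (hg _).symm
        · rw [hstep b a h]; exact hg _ }
  refine ⟨_, (SimpleGraph.cycleGraph.cycle m).map φ, SimpleGraph.Walk.IsHamiltonianCycle.map hbij ?_⟩
  rw [SimpleGraph.Walk.isHamiltonianCycle_iff_isCycle_and_length_eq]
  exact ⟨SimpleGraph.cycleGraph.isCycle_cycle, by simp [SimpleGraph.cycleGraph.length_cycle]⟩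

/-! ### Bitstrings as words, and the graph on the middle four levels -/

theorem exc_ofFn {N : ℕ} (x : Bitstring N) : exc (List.ofFn x) = 2 * (weight x : ℤ) - N := by
  have h : exc (List.ofFn x) = ∑ i, (2 * (if x i = true then 1 else 0) - 1 : ℤ) := by
    induction N with
    | zero => simp
    | succ N ih =>
      rw [List.ofFn_succ, Fin.sum_univ_succ, ← ih fun i => x i.succ]
      cases x 0 <;> simp <;> ring
  rw [h, Finset.sum_sub_distrib, ← Finset.mul_sum, Finset.sum_boole]
  simp [weight]

theorem hammingDist_eq_one_of_flipAdj {N : ℕ} {x y : Bitstring N}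
    (h : FlipAdj (List.ofFn x) (List.ofFn y)) : hammingDist x y = 1 := by
  obtain ⟨s, b, t, hx, hy⟩ := h
  have hN : s.length < N := by
    have := congrArg List.length hx
    simp at this; omega
  rw [hammingDist, Finset.card_eq_one]
  refine ⟨⟨s.length, hN⟩, ?_⟩
  ext i
  have hxi : (s ++ b :: t)[(i : ℕ)]? = some (x i) := by rw [← hx]; simp
  have hyi : (s ++ (!b) :: t)[(i : ℕ)]? = some (y i) := by rw [← hy]; simp
  simp only [Finset.mem_filter, Finset.mem_univ, true_and, Finset.mem_singleton, Fin.ext_iff]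
  rcases lt_trichotomy (i : ℕ) s.length with hi | hi | hi
  · rw [List.getElem?_append_left hi] at hxi hyi
    have : x i = y i := by rw [hxi] at hyi; simpa using hyi
    simp [this, hi.ne]
  · rw [hi] at hxi hyi
    simp at hxi hyi
    rw [← hxi, hyi]
    simp [hi]
  · obtain ⟨k, hk⟩ : ∃ k, (i : ℕ) = s.length + (k + 1) := ⟨i - s.length - 1, by omega⟩
    rw [List.getElem?_append_right hi.le, hk] at hxi hyi
    simp at hxi hyi
    have : x i = y i := by rw [hxi] at hyi; simpa using hyi
    simp [this, hi.ne']

/-- Words of length `N` in the middle four levels. -/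
def IsCentral (N : ℕ) (w : List Bool) : Prop :=
  w.length = N ∧ (exc w = 3 ∨ exc w = 1 ∨ exc w = -1 ∨ exc w = -3)

/-- The type of words of length `N` in the middle four levels. -/
abbrev CentralWord (N : ℕ) : Type := {w : List Bool // IsCentral N w}

instance (N : ℕ) : Finite (CentralWord N) :=
  ((List.finite_length_eq Bool N).subset fun _ hw => hw.1).to_subtype

theorem IsCentral.revCompl {N : ℕ} {w : List Bool} (h : IsCentral N w) :
    IsCentral N (revCompl w) := by
  obtain ⟨h1, h2⟩ := h
  refine ⟨by simpa using h1, ?_⟩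
  simp only [exc_revCompl]; omega

theorem MatchUp.isCentral_left {N : ℕ} {x y : List Bool} (h : MatchUp x y) (hl : x.length = N) :
    IsCentral N x := by
  have := h.exc_cases
  exact ⟨hl, by omega⟩

theorem MatchUp.isCentral_right {N : ℕ} {x y : List Bool} (h : MatchUp x y) (hl : y.length = N) :
    IsCentral N y := by
  have := h.exc_cases
  have := h.exc_eq
  exact ⟨hl, by omega⟩

theorem Matched.isCentral {N : ℕ} {x y : List Bool} (h : Matched x y) (hl : x.length = N) :
    IsCentral N y :=
  have hl' : y.length = N := h.flipAdj.length_eq ▸ hl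
  h.elim (·.isCentral_right hl') (·.isCentral_left hl')

theorem IsCentral.exists_matched {N : ℕ} {x : List Bool} (h : IsCentral N x) (hN : 2 ≤ N) :
    ∃ y, IsCentral N y ∧ Matched x y := by
  obtain ⟨hl, h3 | h1 | h1 | h3⟩ := h
  · obtain ⟨y, hy⟩ := exists_matched_of_exc_three h3
    exact ⟨y, hy.isCentral hl, hy⟩
  · obtain ⟨y, hy⟩ := exists_matched_of_exc_one h1 (by omega)
    exact ⟨y, hy.isCentral hl, hy⟩
  · obtain ⟨y, hy⟩ := exists_matched_of_exc_neg_one h1 (by omega)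
    exact ⟨y, hy.isCentral hl, hy⟩
  · obtain ⟨y, hy⟩ := exists_matched_of_exc_neg_three h3
    exact ⟨y, hy.isCentral hl, hy⟩

theorem Matched.exc_mod {x y : List Bool} (h : Matched x y) (hx : exc x % 2 = 1) :
    exc y % 4 = 3 ↔ ¬ exc x % 4 = 3 := by
  rcases h with h | h <;> have := h.exc_eq <;> omega

theorem IsCentral.exc_mod_two {N : ℕ} {x : List Bool} (h : IsCentral N x) : exc x % 2 = 1 := by
  have := h.2; omega

theorem FlipAdj.ne {x y : List Bool} (h : FlipAdj x y) : x ≠ y := by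
  obtain ⟨s, b, t, rfl, rfl⟩ := h
  simp

theorem exc_replicate (k : ℕ) (b : Bool) : exc (List.replicate k b) = if b then (k : ℤ) else -k := by
  induction k with
  | zero => simp
  | succ k ih => cases b <;> simp [List.replicate_succ, ih]; ring

theorem two_lt_card_centralWord (n : ℕ) [Fintype (CentralWord (2 * n + 3))] :
    2 < Fintype.card (CentralWord (2 * n + 3)) := by
  rw [Fintype.two_lt_card_iff]
  refine ⟨⟨List.replicate (n + 1) false ++ List.replicate (n + 2) true, ?_, ?_⟩,
    ⟨List.replicate (n + 2) false ++ List.replicate (n + 1) true, ?_, ?_⟩,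
    ⟨List.replicate (n + 2) true ++ List.replicate (n + 1) false, ?_, ?_⟩, ?_, ?_, ?_⟩
  · simp; ring
  · simp [exc_replicate]
  · simp; ring
  · simp [exc_replicate]
  · simp; ring
  · refine .inr (.inl ?_)
    simp [exc_replicate]; ring
  · intro h
    have := congrArg (fun w => exc w.1) h
    simp [exc_replicate] at this
  · simp [List.replicate_succ]
  · simp [List.replicate_succ]

/-- The graph on the words in the middle four levels. -/
def centralGraph (N : ℕ) : SimpleGraph (CentralWord N) where
  Adj x y := FlipAdj x.1 y.1
  symm := ⟨fun _ _ h => h.symm⟩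
  loopless := ⟨fun _ h => h.ne rfl⟩

/-- Two words span together with their partners a quadrilateral in the direction of the last
bit. -/
def IsQuad {N : ℕ} (m : CentralWord N → CentralWord N) (w z : CentralWord N) : Prop :=
  ∃ x y b, w.1 = x ++ [b] ∧ (m w).1 = y ++ [b] ∧ z.1 = y ++ [!b] ∧ (m z).1 = x ++ [!b]

theorem IsQuad.symm {N : ℕ} {m : CentralWord N → CentralWord N} {w z : CentralWord N}
    (h : IsQuad m w z) : IsQuad m z w := by
  obtain ⟨x, y, b, h1, h2, h3, h4⟩ := h
  exact ⟨y, x, !b, h3, h4, by simpa using h1, by simpa using h2⟩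

theorem IsQuad.unique {N : ℕ} {m : CentralWord N → CentralWord N} {w z z' : CentralWord N}
    (h : IsQuad m w z) (h' : IsQuad m w z') : z = z' := by
  obtain ⟨x, y, b, h1, h2, h3, h4⟩ := h
  obtain ⟨x', y', b', h1', h2', h3', h4'⟩ := h'
  have e := List.append_inj' (h2.symm.trans h2') rfl
  rw [Subtype.ext_iff, h3, h3', e.1, (List.cons.inj e.2).1]

open scoped Classical in
/-- The exchange of partners along quadrilaterals, for words of excess `3` and `-1`. -/
noncomputable def exchange {N : ℕ} (m : CentralWord N → CentralWord N) (w : CentralWord N) :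
    CentralWord N :=
  if h : exc w.1 % 4 = 3 ∧ ∃ z, IsQuad m w z then h.2.choose else w

theorem exchange_eq {N : ℕ} {m : CentralWord N → CentralWord N} {w z : CentralWord N}
    (h : exc w.1 % 4 = 3) (hz : IsQuad m w z) : exchange m w = z := by
  have h' : exc w.1 % 4 = 3 ∧ ∃ z, IsQuad m w z := ⟨h, z, hz⟩
  rw [exchange, dif_pos h']
  exact h'.2.choose_spec.unique hz

/-- The partner of `z` differs from both `z` and `w` in one bit, so `z` and `w` are in the same
class of the bipartition by excess modulo 4. -/
theorem IsQuad.exc_mod {N : ℕ} {m : CentralWord N → CentralWord N}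
    (hm : ∀ w, Matched w.1 (m w).1) {w z : CentralWord N}
    (h : IsQuad m w z) (hw : exc w.1 % 4 = 3) : exc z.1 % 4 = 3 := by
  have h1 := (hm z).exc_mod z.2.exc_mod_two
  obtain ⟨x, y, b, e1, e2, e3, e4⟩ := h
  rw [e4] at h1
  rw [e1] at hw
  cases b <;> simp at h1 hw <;> omega

theorem hasHamiltonCycle_centralGraph {n N : ℕ} (hN : N = 2 * n + 3)
    [DecidableEq (CentralWord N)] : HasHamiltonCycle (centralGraph N) := by
  classical
  have : Fintype (CentralWord N) := Fintype.ofFinite _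
  have hex : ∀ w : CentralWord N, ∃ z : CentralWord N, Matched w.1 z.1 := by
    intro w
    obtain ⟨y, hy, h⟩ := w.2.exists_matched (by omega)
    exact ⟨⟨y, hy⟩, h⟩
  choose a ha using hex
  have ha_eq : ∀ w z : CentralWord N, Matched w.1 z.1 → a w = z := fun w z h =>
    Subtype.ext ((ha w).unique h)
  have haa : ∀ w, a (a w) = w := fun w => ha_eq _ _ (ha w).symm
  let c : CentralWord N → CentralWord N := fun w => ⟨revCompl w.1, w.2.revCompl⟩
  have hcc : ∀ w, c (c w) = w := fun w => Subtype.ext (by simp [c])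
  let b : CentralWord N → CentralWord N := fun w => c (a (c w))
  have hbb : ∀ w, b (b w) = w := fun w => by simp [b, hcc, haa]
  have hodd : ∀ w : CentralWord N, exc w.1 % 2 = 1 := fun w => w.2.exc_mod_two
  have hap : ∀ w, exc (a w).1 % 4 = 3 ↔ ¬ exc w.1 % 4 = 3 := fun w => (ha w).exc_mod (hodd w)
  have hcp : ∀ w, exc (c w).1 % 4 = 3 ↔ ¬ exc w.1 % 4 = 3 := fun w => by
    have := hodd w
    simp only [c, exc_revCompl]; omega
  have hbp : ∀ w, exc (b w).1 % 4 = 3 ↔ ¬ exc w.1 % 4 = 3 := fun w => by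
    simp only [b, hcp, hap]; tauto
  have hb : ∀ w, FlipAdj w.1 (b w).1 := fun w => by
    have := (ha (c w)).flipAdj.revCompl
    simpa [b, c] using this
  -- Using the matching on the class of excess 3 and -1, and its mirror image on the other class,
  -- orients the cycles of the union consistently.
  let f : Equiv.Perm (CentralWord N) :=
    { toFun := fun w => if exc w.1 % 4 = 3 then a w else b w
      invFun := fun w => if exc w.1 % 4 = 3 then b w else a w
      left_inv := fun w => by
        by_cases h : exc w.1 % 4 = 3
        · simp [h, hap, haa]
        · simp [h, hbp, hbb]
      right_inv := fun w => by
        by_cases h : exc w.1 % 4 = 3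
        · simp [h, hbp, hbb]
        · simp [h, hap, haa] }
  have hfa : ∀ w, exc w.1 % 4 = 3 → f w = a w := fun w h => if_pos h
  have hfb : ∀ w, ¬ exc w.1 % 4 = 3 → f w = b w := fun w h => if_neg h
  have hf : ∀ w, FlipAdj w.1 (f w).1 := fun w => by
    by_cases h : exc w.1 % 4 = 3
    · rw [hfa w h]; exact (ha w).flipAdj
    · rw [hfb w h]; exact hb w
  have hs : ∀ w, (exchange a w = w) ∨ (exc w.1 % 4 = 3 ∧ IsQuad a w (exchange a w)) := by
    intro w
    by_cases h : exc w.1 % 4 = 3 ∧ ∃ z, IsQuad a w z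
    · obtain ⟨h, z, hz⟩ := h
      exact .inr ⟨h, (exchange_eq h hz).symm ▸ hz⟩
    · exact .inl (dif_neg h)
  obtain ⟨g, hg, hgc⟩ := exists_single_cycle (fun w z : CentralWord N => FlipAdj w.1 z.1) f
    (exchange a) hf
    (fun w => by
      rcases hs w with h | ⟨h1, h2⟩
      · rw [h, h]
      · exact exchange_eq (h2.exc_mod ha h1) h2.symm)
    (fun w => by
      rcases hs w with h | ⟨h1, h2⟩
      · rw [h]; exact hf w
      · rw [hfa _ (h2.exc_mod ha h1)]
        obtain ⟨x, y, b, e1, e2, e3, e4⟩ := h2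
        rw [e1, e4]
        exact ⟨x, b, [], rfl, rfl⟩)
    (by
      intro R hRf hRs
      have hRa : ∀ w, R w (a w) := fun w => by
        by_cases h : exc w.1 % 4 = 3
        · exact hfa w h ▸ hRf w
        · have := hRf (a w)
          rw [hfa _ ((hap w).2 h), haa] at this
          exact R.symm this
      have hRb : ∀ w, R w (b w) := fun w => by
        by_cases h : exc w.1 % 4 = 3
        · have := hRf (b w)
          rw [hfb _ (fun h' => (hbp w).1 h' h), hbb] at this
          exact R.symm this
        · exact hfb w h ▸ hRf w
      -- The label is the class of the word. The value `none` elsewhere makes the invariance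
      -- conditions trivial for words of other lengths.
      let F : List Bool → Option (Quotient R) := fun w =>
        if h : IsCentral N w then some (Quotient.mk R ⟨w, h⟩) else none
      have hF : ∀ w : CentralWord N, F w.1 = some (Quotient.mk R w) := fun w => dif_pos w.2
      have hFeq : ∀ w z : CentralWord N, R w z → F w.1 = F z.1 := fun w z h => by
        rw [hF, hF, Quotient.sound h]
      have hFnone : ∀ w : List Bool, w.length ≠ N → F w = none := fun w h =>
        dif_neg fun h' => h h'.1
      have inv : CubeInvariant F :=
        { up := fun x y h => by
            have hl := h.flipAdj.length_eq
            by_cases hx : x.length = N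
            · have := ha_eq ⟨x, h.isCentral_left hx⟩ ⟨y, h.isCentral_right (hl ▸ hx)⟩ (.inl h)
              exact hFeq ⟨x, _⟩ ⟨y, _⟩ (this ▸ hRa _)
            · rw [hFnone x hx, hFnone y (hl ▸ hx)]
          mirror := fun x y h => by
            have hl := h.flipAdj.length_eq
            by_cases hx : x.length = N
            · have := ha_eq ⟨x, h.isCentral_left hx⟩ ⟨y, h.isCentral_right (hl ▸ hx)⟩ (.inl h)
              have h2 := hRb (c ⟨x, h.isCentral_left hx⟩)
              simp only [b, hcc, this] at h2
              exact hFeq _ _ h2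
            · rw [hFnone _ (by simpa using hx), hFnone _ (by simpa using hl ▸ hx)]
          quad := fun x y h h' => by
            have hl := h.flipAdj.length_eq
            by_cases hx : (x ++ [false]).length = N
            · have hx' : (x ++ [true]).length = N := by simpa using hx
              have hy : (y ++ [false]).length = N := hl ▸ hx
              have hy' : (y ++ [true]).length = N := by simpa using hy
              have e := ha_eq ⟨_, h.isCentral_left hx⟩ ⟨_, h.isCentral_right hy⟩ (.inl h)
              have e' := ha_eq ⟨_, h'.isCentral_left hx'⟩ ⟨_, h'.isCentral_right hy'⟩ (.inl h')
              generalize hw : (⟨x ++ [false], h.isCentral_left hx⟩ : CentralWord N) = w at e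
              generalize hz : (⟨y ++ [false], h.isCentral_right hy⟩ : CentralWord N) = z at e
              generalize hw' : (⟨x ++ [true], h'.isCentral_left hx'⟩ : CentralWord N) = w' at e'
              generalize hz' : (⟨y ++ [true], h'.isCentral_right hy'⟩ : CentralWord N) = z' at e'
              have ez : a z = w := by rw [← e, haa]
              have ez' : a z' = w' := by rw [← e', haa]
              -- Exchanges act only on one class of the bipartition, so the diagonal used is the one
              -- whose ends have excess 3 modulo 4; a matching edge completes the path.
              have key : R w w' := by
                by_cases hp : exc w.1 % 4 = 3
                · have q : IsQuad a w z' :=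
                    ⟨x, y, false, by rw [← hw], by rw [e, ← hz], by rw [← hz']; rfl,
                      by rw [ez', ← hw']; rfl⟩
                  exact R.trans (exchange_eq hp q ▸ hRs w) (ez' ▸ hRa z')
                · have q : IsQuad a z w' :=
                    ⟨y, x, false, by rw [← hz], by rw [ez, ← hw], by rw [← hw']; rfl,
                      by rw [e', ← hz']; rfl⟩
                  have hp' : exc z.1 % 4 = 3 := e ▸ (hap w).2 hp
                  exact R.trans (e ▸ hRa w) (exchange_eq hp' q ▸ hRs z)
              have := hFeq _ _ key
              rwa [← hw, ← hw'] at this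
            · rw [hFnone _ hx, hFnone _ (by simpa using hx)] }
      intro w z
      have h1 := (inv.eq (w.2.1.trans hN) w.2.2).trans (inv.eq (z.2.1.trans hN) z.2.2).symm
      rw [hF, hF] at h1
      exact Quotient.exact (Option.some.inj h1))
  subst hN
  exact hasHamiltonCycle_of_perm (centralGraph _) g hg hgc (two_lt_card_centralWord n)

theorem theorem1 (n : ℕ) (hn : 1 ≤ n) :
    HasHamiltonCycle ((cube (2 * n + 1)).induce (levels (2 * n + 1) (n - 1) (n + 2))) := by
  classical
  obtain ⟨n, rfl⟩ : ∃ m, n = m + 1 := ⟨n - 1, by omega⟩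
  obtain ⟨v, p, hp⟩ := hasHamiltonCycle_centralGraph (n := n) rfl
  have hlev : ∀ x : Bitstring (2 * (n + 1) + 1),
      x ∈ levels (2 * (n + 1) + 1) (n + 1 - 1) (n + 1 + 2) ↔ IsCentral (2 * n + 3) (List.ofFn x) := by
    intro x
    have := exc_ofFn x
    simp only [levels, Set.mem_ofPred_eq, IsCentral, List.length_ofFn]
    push_cast at this
    omega
  let φ : levels (2 * (n + 1) + 1) (n + 1 - 1) (n + 1 + 2) → CentralWord (2 * n + 3) :=
    fun x => ⟨List.ofFn x.1, (hlev x.1).1 x.2⟩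
  have hφ : Function.Bijective φ := by
    refine ⟨fun x y h => ?_, fun w => ?_⟩
    · exact Subtype.ext (List.ofFn_injective (congrArg Subtype.val h))
    · obtain ⟨w, hw⟩ := w
      obtain ⟨x, rfl⟩ : ∃ x : Bitstring (2 * (n + 1) + 1), List.ofFn x = w :=
        ⟨fun i => w[i]'(by have := hw.1; omega), by
          apply List.ext_getElem
          · simp [hw.1]
          · intro i h1 h2
            rw [List.getElem_ofFn]; rfl⟩
      exact ⟨⟨x, (hlev x).2 hw⟩, rfl⟩
  let e := Equiv.ofBijective φ hφ
  let ψ : centralGraph (2 * n + 3) →g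
      (cube (2 * (n + 1) + 1)).induce (levels (2 * (n + 1) + 1) (n + 1 - 1) (n + 1 + 2)) :=
    { toFun := e.symm
      map_rel' := by
        intro w z h
        obtain ⟨x, rfl⟩ := e.surjective w
        obtain ⟨y, rfl⟩ := e.surjective z
        rw [e.symm_apply_apply, e.symm_apply_apply]
        exact hammingDist_eq_one_of_flipAdj h }
  have := SimpleGraph.Walk.IsHamiltonianCycle.map (f := ψ) e.symm.bijective hp
  exact ⟨_, _, by convert this⟩
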